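/- Let $\Delta_+$ be the category of the ordinals $[n]=\{0<\dots<n\}$, $n\ge 0$, and injective monotone maps. A semisimplicial set is a presheaf on $\Delta_+$; $\Delta^n$ denotes the representable on $[n]$. Let $U$ be the functor from simplicial sets to semisimplicial sets that forgets degeneracies, $L$ its left adjoint (the free simplicial set functor), and $\eta\colon \mathrm{Id}\to UL$ the unit of the adjunction $L\dashv U$. A cofibration of semisimplicial sets is a levelwise decidable monomorphism. For $n\ge1$ and $0\le k\le n$, the horn $\Lambda^n_k\subseteq\Delta^n$ consists of the faces of $\Delta^n$ that omit some vertex $j\ne k$. A fibration is a map with the right lifting property against all horn inclusions $\Lambda^n_k\to\Delta^n$ ($n\ge 1$, $0\le k\le n$); an anodyne map is a map with the left lifting property against all fibrations; and $X$ is fibrant if $X\to 1$ is a fibration, where $1$ is the terminal semisimplicial set. The geometric product $A\otimes B$ has as $n$-simplices the jointly monic pairs of surjective monotone maps $[n]\to[a]$, $[n]\to[b]$ together with an $a$-simplex of $A$ and a $b$-simplex of $B$; an injection $[m]\to[n]$ acts by composing with the two surjections, factoring each composite as a surjection followed by an injection, and restricting the simplices of $A$ and $B$ along these injections. The unit of $\otimes$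 is $\Delta^0$. A homotopy from $f_0\colon X\to Y$ to $f_1\colon X\to Y$ is a map $\Delta^1\otimes X\to Y$ that restricts to $f_0$ and $f_1$ along the inclusions $X\cong\Delta^0\otimes X\to\Delta^1\otimes X$ given by the vertices $0$ and $1$ of $\Delta^1$. A map $f\colon X\to Y$ is a homotopy equivalence if there are $g\colon Y\to X$ and homotopies from $gf$ to $\mathrm{id}_X$ and from $fg$ to $\mathrm{id}_Y$. A map $f\colon A\to B$ of semisimplicial sets is a weak equivalence if there are fibrant semisimplicial sets $X$ and $Y$, anodyne maps $i\colon A\to X$ and $j\colon B\to Y$, and a homotopy equivalence $g\colon X\to Y$ with $gi=jf$. **Lemma.** For every semisimplicial set $A$, the unit $\eta_A\colon A\to ULA$ is a cofibration and a weak equivalence. -/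

import Mathlib

open CategoryTheory Opposite Simplicial

universe u

/-- Semisimplicial sets: presheaves on the category of finite nonempty ordinals and monomorphisms. -/
abbrev SemiSSet : Type (u + 1) := SemiSimplexCategoryᵒᵖ ⥤ Type u

namespace SemiSSet

open SemiSimplexCategory (toSimplexCategory homOfMono homEquiv)

/-- The underlying semisimplicial set of a simplicial set, forgetting degeneracies. -/
def forgetDegeneracies : SSet.{u} ⥤ SemiSSet.{u} :=
  (Functor.whiskeringLeft _ _ _).obj toSimplexCategory.op

/-! ### The free simplicial set on a semisimplicial set -/

/-- An `n`-simplex of the free simplicial set on `A`: a simplex of `A` of some dimension `a`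
together with an epimorphism `[n] ⟶ [a]` in the simplex category. -/
structure FreeSimplex (A : SemiSSet.{u}) (n : SimplexCategory) : Type u where
  dim : SemiSimplexCategory
  proj : n ⟶ toSimplexCategory.obj dim
  epi : Epi proj
  simplex : A.obj (op dim)

namespace FreeSimplex

variable {A B : SemiSSet.{u}}

/-- The image of a map `f : [m] ⟶ [a]`, as an object of the semisimplex category. -/
noncomputable def imageDim {m : SimplexCategory} {a : SemiSimplexCategory}
    (f : m ⟶ toSimplexCategory.obj a) : SemiSimplexCategory :=
  ⟨(Limits.image f).len⟩

/-- The epimorphism in the (epi, mono) factorization of `f`. -/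
noncomputable def imageProj {m : SimplexCategory} {a : SemiSimplexCategory}
    (f : m ⟶ toSimplexCategory.obj a) : m ⟶ toSimplexCategory.obj (imageDim f) :=
  Limits.factorThruImage f

/-- The monomorphism in the (epi, mono) factorization of `f`. -/
noncomputable def imageIncl {m : SimplexCategory} {a : SemiSimplexCategory}
    (f : m ⟶ toSimplexCategory.obj a) : imageDim f ⟶ a :=
  have : Mono (C := SimplexCategory) (X := toSimplexCategory.obj (imageDim f))
    (Limits.image.ι f) := inferInstanceAs (Mono (Limits.image.ι f))
  homOfMono (n := imageDim f) (Limits.image.ι f)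

theorem epi_imageProj {m : SimplexCategory} {a : SemiSimplexCategory}
    (f : m ⟶ toSimplexCategory.obj a) : Epi (imageProj f) :=
  inferInstanceAs (Epi (Limits.factorThruImage f))

@[simp]
theorem imageProj_imageIncl {m : SimplexCategory} {a : SemiSimplexCategory}
    (f : m ⟶ toSimplexCategory.obj a) : imageProj f ≫ toSimplexCategory.map (imageIncl f) = f := by
  have : Mono (C := SimplexCategory) (X := toSimplexCategory.obj (imageDim f))
    (Limits.image.ι f) := inferInstanceAs (Mono (Limits.image.ι f))
  have h : toSimplexCategory.map (imageIncl f) = Limits.image.ι f :=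
    SemiSimplexCategory.toSimplexCategory_map_homOfMono (n := imageDim f) _
  rw [h]
  exact Limits.image.fac f

/-- The action of `f : [m] ⟶ [n]`: factor `f ≫ proj` as an epimorphism followed by
a monomorphism, and restrict the simplex along the monomorphism. -/
noncomputable def restrict {m n : SimplexCategory} (f : m ⟶ n) (x : FreeSimplex A n) :
    FreeSimplex A m where
  dim := imageDim (f ≫ x.proj)
  proj := imageProj (f ≫ x.proj)
  epi := epi_imageProj _
  simplex := A.map (imageIncl (f ≫ x.proj)).op x.simplex

theorem restrict_eq {m n : SimplexCategory} (f : m ⟶ n) (x : FreeSimplex A n)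
    {d : SemiSimplexCategory} (e : m ⟶ toSimplexCategory.obj d) (he : Epi e) (i : d ⟶ x.dim)
    (fac : e ≫ toSimplexCategory.map i = f ≫ x.proj) :
    x.restrict f = ⟨d, e, he, A.map i.op x.simplex⟩ := by
  have key : ∀ (d' : SemiSimplexCategory) (e' : m ⟶ toSimplexCategory.obj d') (he' : Epi e')
      (i' : d' ⟶ x.dim), e' ≫ toSimplexCategory.map i' = f ≫ x.proj →
      (⟨d', e', he', A.map i'.op x.simplex⟩ : FreeSimplex A m) =
        ⟨d, e, he, A.map i.op x.simplex⟩ := by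
    intro d' e' he' i' fac'
    have h1 := SimplexCategory.image_eq fac
    have h2 := SimplexCategory.image_eq fac'
    obtain rfl : d' = d := by
      ext
      exact congrArg SimplexCategory.len (h2.symm.trans h1)
    have := strongEpi_of_epi e
    have := strongEpi_of_epi e'
    let φ := Limits.image.isoStrongEpiMono e _ fac
    let φ' := Limits.image.isoStrongEpiMono e' _ fac'
    have h3 := SimplexCategory.iso_eq_iso_refl (φ' ≪≫ φ.symm)
    have h4 : φ' = φ := by
      have := congrArg (· ≪≫ φ) h3
      simpa using this
    obtain rfl : i' = i := by
      apply toSimplexCategory.map_injective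
      have a1 := Limits.image.isoStrongEpiMono_hom_comp_ι e _ fac
      have a2 := Limits.image.isoStrongEpiMono_hom_comp_ι e' _ fac'
      rw [← a1, ← a2]
      exact congrArg (fun t => Iso.hom t ≫ _) h4
    obtain rfl : e' = e := by
      rw [← cancel_mono (toSimplexCategory.map i'), fac, fac']
    rfl
  exact key _ _ _ _ (imageProj_imageIncl _)

theorem restrict_id {n : SimplexCategory} (x : FreeSimplex A n) : x.restrict (𝟙 n) = x := by
  rw [restrict_eq (𝟙 n) x x.proj x.epi (𝟙 _) (by simp)]
  simp

theorem restrict_comp {k m n : SimplexCategory} (g : k ⟶ m) (f : m ⟶ n) (x : FreeSimplex A n) :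
    x.restrict (g ≫ f) = (x.restrict f).restrict g := by
  rw [restrict_eq (g ≫ f) x ((x.restrict f).restrict g).proj ((x.restrict f).restrict g).epi
    (imageIncl (g ≫ (x.restrict f).proj) ≫ imageIncl (f ≫ x.proj))]
  · simp only [restrict, op_comp, Functor.map_comp]
    rfl
  · simp only [restrict, Functor.map_comp, Category.assoc]
    rw [← Category.assoc, imageProj_imageIncl, Category.assoc, imageProj_imageIncl]

/-- Functoriality in the semisimplicial set. -/
def map (φ : A ⟶ B) {n : SimplexCategory} (x : FreeSimplex A n) : FreeSimplex B n :=
  ⟨x.dim, x.proj, x.epi, φ.app _ x.simplex⟩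

theorem map_restrict (φ : A ⟶ B) {m n : SimplexCategory} (f : m ⟶ n) (x : FreeSimplex A n) :
    (x.restrict f).map φ = (x.map φ).restrict f := by
  simp only [restrict, map]
  congr 1
  exact NatTrans.naturality_apply φ _ _

end FreeSimplex

/-- The free simplicial set functor. -/
noncomputable def free : SemiSSet.{u} ⥤ SSet.{u} where
  obj A :=
    { obj n := FreeSimplex A n.unop
      map f := ↾(FreeSimplex.restrict f.unop)
      map_id _ := ConcreteCategory.hom_ext _ _ fun x => x.restrict_id
      map_comp f g := ConcreteCategory.hom_ext _ _ fun x => x.restrict_comp g.unop f.unop }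
  map φ :=
    { app n := ↾(FreeSimplex.map φ)
      naturality _ _ f := ConcreteCategory.hom_ext _ _ fun x => x.map_restrict φ f.unop }

/-- A simplex of `A` as a simplex of the free simplicial set. -/
def freeUnit (A : SemiSSet.{u}) : A ⟶ forgetDegeneracies.obj (free.obj A) where
  app n := ↾(fun x => (⟨n.unop, 𝟙 _, inferInstance, x⟩ : FreeSimplex A _))
  naturality m n f := ConcreteCategory.hom_ext _ _ fun x => by
    symm
    refine (FreeSimplex.restrict_eq (A := A) (toSimplexCategory.map f.unop)
      ⟨m.unop, 𝟙 _, inferInstance, x⟩ (d := n.unop) (𝟙 _) inferInstance f.unop ?_)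
    simp

/-- Evaluation of formal degeneracies in a simplicial set. -/
def freeCounit (Y : SSet.{u}) : free.obj (forgetDegeneracies.obj Y) ⟶ Y where
  app n := ↾(fun x : FreeSimplex (forgetDegeneracies.obj Y) n.unop => Y.map x.proj.op x.simplex)
  naturality m n f := ConcreteCategory.hom_ext _ _ fun x => by
    change Y.map (FreeSimplex.imageProj (f.unop ≫ x.proj)).op
      (Y.map (toSimplexCategory.map (FreeSimplex.imageIncl (f.unop ≫ x.proj))).op x.simplex) =
      Y.map f (Y.map x.proj.op x.simplex)
    have h := congrArg (fun t => Y.map (Quiver.Hom.op t) x.simplex)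
      (FreeSimplex.imageProj_imageIncl (f.unop ≫ x.proj))
    simp only [op_comp, Functor.map_comp] at h
    exact h

/-- The free simplicial set functor is left adjoint to forgetting degeneracies. -/
noncomputable def freeAdjunction : free.{u} ⊣ forgetDegeneracies.{u} :=
  Adjunction.mkOfUnitCounit
    { unit := { app := freeUnit }
      counit :=
        { app := freeCounit
          naturality Y Z φ := by
            ext n x
            exact (NatTrans.naturality_apply φ _ _).symm }
      left_triangle := by
        ext A n x
        change FreeSimplex.restrict x.proj ⟨x.dim, 𝟙 _, inferInstance, x.simplex⟩ = x
        rw [FreeSimplex.restrict_eq (A := A) x.proj ⟨x.dim, 𝟙 _, inferInstance, x.simplex⟩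
          x.proj x.epi (𝟙 _) (by simp)]
        exact congrArg (FreeSimplex.mk x.dim x.proj x.epi)
          (congrArg (fun t => t x.simplex) (A.map_id (op x.dim)))
      right_triangle := by
        ext Y n x
        exact congrArg (fun t => t x) (Y.map_id _) }

/-! ### Cofibrations, anodyne maps and fibrations -/

/-- The standard `n`-simplex, represented by `[n]`. -/
def stdSimplex (n : ℕ) : SemiSSet.{u} := uliftYoneda.{u}.obj ⦋n⦌ₛ

/-- The order embedding `[m] ⟶ [n]` corresponding to an `m`-simplex of `Δ^n`. -/
def stdSimplex.embedding {n : ℕ} {m : SemiSimplexCategoryᵒᵖ} (f : (stdSimplex.{u} n).obj m) :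
    Fin (m.unop.len + 1) ↪o Fin (n + 1) :=
  homEquiv (ULift.down (α := m.unop ⟶ ⦋n⦌ₛ) f)

theorem stdSimplex.embedding_map {n : ℕ} {m m' : SemiSimplexCategoryᵒᵖ} (g : m ⟶ m')
    (f : (stdSimplex.{u} n).obj m) : stdSimplex.embedding ((stdSimplex.{u} n).map g f) =
      (homEquiv g.unop).trans (stdSimplex.embedding f) :=
  SemiSimplexCategory.homEquiv_comp _ _

/-- The horn `Λ^n_k`: the simplices of `Δ^n` missing some vertex different from `k`. -/
def horn (n : ℕ) (k : Fin (n + 1)) : Subfunctor (stdSimplex.{u} n) where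
  obj _ := {f | ∃ j, j ≠ k ∧ j ∉ Set.range (stdSimplex.embedding f)}
  map g f := by
    rintro ⟨j, hj, hf⟩
    refine ⟨j, hj, fun ⟨i, hi⟩ => hf ⟨homEquiv g.unop i, ?_⟩⟩
    rw [stdSimplex.embedding_map] at hi
    exact hi

/-- The horn inclusions `Λ^n_k ⟶ Δ^n` for `n ≥ 1` and `0 ≤ k ≤ n`. -/
inductive HornInclusions : MorphismProperty SemiSSet.{u} where
  | mk (n : ℕ) (hn : 1 ≤ n) (k : Fin (n + 1)) : HornInclusions (Subfunctor.ι (horn.{u} n k))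

/-- Fibrations: maps with the right lifting property against horn inclusions. -/
def fibrations : MorphismProperty SemiSSet.{u} :=
  MorphismProperty.rlp HornInclusions

/-- Anodyne maps: the weak saturation of the horn inclusions, i.e. the maps with the left
lifting property against fibrations. -/
def anodyne : MorphismProperty SemiSSet.{u} := fibrations.llp

/-- Cofibrations: levelwise decidable monomorphisms. -/
def cofibrations : MorphismProperty SemiSSet.{u} := fun _ B m =>
  ∀ n, Function.Injective (m.app n) ∧
    ∀ b : B.obj n, b ∈ Set.range (m.app n) ∨ b ∉ Set.range (m.app n)

/-- `X` is fibrant if the map to the terminal semisimplicial set is a fibration. -/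
def IsFibrant (X : SemiSSet.{u}) : Prop := fibrations (Limits.terminal.from X)

/-! ### The geometric product and homotopies -/

/-- An `n`-simplex of the geometric product `A ⊗ B`: epimorphisms `p : [n] ⟶ [a]` and
`q : [n] ⟶ [b]` that are jointly monic, an `a`-simplex of `A` and a `b`-simplex of `B`. -/
structure GeomProdSimplex (A B : SemiSSet.{u}) (n : SemiSimplexCategory) : Type u where
  fst : FreeSimplex A (toSimplexCategory.obj n)
  snd : FreeSimplex B (toSimplexCategory.obj n)
  jointly_monic : Function.Injective fun i => (fst.proj.toOrderHom i, snd.proj.toOrderHom i)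

namespace GeomProdSimplex

variable {A B : SemiSSet.{u}}

theorem ext {n : SemiSimplexCategory} {x y : GeomProdSimplex A B n} (h : x.fst = y.fst)
    (h' : x.snd = y.snd) : x = y := by
  cases x; cases y; subst h h'; rfl

/-- The action of a monomorphism `f : [m] ⟶ [n]`: restrict both components. -/
noncomputable def restrict {m n : SemiSimplexCategory} (f : m ⟶ n) (x : GeomProdSimplex A B n) :
    GeomProdSimplex A B m where
  fst := x.fst.restrict (toSimplexCategory.map f)
  snd := x.snd.restrict (toSimplexCategory.map f)
  jointly_monic i j h := by
    have h1 := congrArg Prod.fst h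
    have h2 := congrArg Prod.snd h
    apply (homEquiv f).injective
    apply x.jointly_monic
    refine Prod.ext ?_ ?_
    · have e := FreeSimplex.imageProj_imageIncl (toSimplexCategory.map f ≫ x.fst.proj)
      have e' := fun k => congrArg (fun t => SimplexCategory.Hom.toOrderHom t k) e
      exact (e' i).symm.trans ((congrArg _ h1).trans (e' j))
    · have e := FreeSimplex.imageProj_imageIncl (toSimplexCategory.map f ≫ x.snd.proj)
      have e' := fun k => congrArg (fun t => SimplexCategory.Hom.toOrderHom t k) e
      exact (e' i).symm.trans ((congrArg _ h2).trans (e' j))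

end GeomProdSimplex

/-- The geometric product of semisimplicial sets. -/
noncomputable def geomProd (A B : SemiSSet.{u}) : SemiSSet.{u} where
  obj n := GeomProdSimplex A B n.unop
  map f := ↾(GeomProdSimplex.restrict f.unop)
  map_id n := ConcreteCategory.hom_ext _ _ fun x : GeomProdSimplex A B n.unop =>
    GeomProdSimplex.ext
      ((congrArg (fun t => x.fst.restrict t) (toSimplexCategory.map_id _)).trans
        x.fst.restrict_id)
      ((congrArg (fun t => x.snd.restrict t) (toSimplexCategory.map_id _)).trans
        x.snd.restrict_id)
  map_comp {n _ _} f g := ConcreteCategory.hom_ext _ _ fun x : GeomProdSimplex A B n.unop =>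
    GeomProdSimplex.ext
      ((congrArg (fun t => x.fst.restrict t) (toSimplexCategory.map_comp g.unop f.unop)).trans
        (x.fst.restrict_comp _ _))
      ((congrArg (fun t => x.snd.restrict t) (toSimplexCategory.map_comp g.unop f.unop)).trans
        (x.snd.restrict_comp _ _))

/-- Functoriality of the geometric product. -/
noncomputable def geomProdMap {A A' B B' : SemiSSet.{u}} (φ : A ⟶ A') (ψ : B ⟶ B') :
    geomProd A B ⟶ geomProd A' B' where
  app n := ↾(fun x : GeomProdSimplex A B n.unop =>
    (⟨x.fst.map φ, x.snd.map ψ, x.jointly_monic⟩ : GeomProdSimplex A' B' n.unop))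
  naturality m _ _ := ConcreteCategory.hom_ext _ _ fun x : GeomProdSimplex A B m.unop =>
    GeomProdSimplex.ext (x.fst.map_restrict φ _) (x.snd.map_restrict ψ _)

/-- The epimorphism `[n] ⟶ [0]`, as a simplex of the free simplicial set on `Δ^0`. -/
def collapse (n : SimplexCategory) : FreeSimplex (stdSimplex.{u} 0) n :=
  ⟨⦋0⦌ₛ, SimplexCategory.const n ⦋0⦌ 0,
    SimplexCategory.epi_iff_surjective.2 fun _ => ⟨0, Subsingleton.elim (α := Fin 1) _ _⟩,
    ULift.up (𝟙 _)⟩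

theorem collapse_restrict {m n : SimplexCategory} (f : m ⟶ n) :
    (collapse.{u} n).restrict f = collapse m := by
  rw [FreeSimplex.restrict_eq (A := stdSimplex 0) f (collapse n) (collapse.{u} m).proj
    (collapse.{u} m).epi (𝟙 _) (Subsingleton.elim (α := m ⟶ ⦋0⦌) _ _)]
  exact congrArg (FreeSimplex.mk ⦋0⦌ₛ _ _)
    (congrArg (fun t => t (collapse n).simplex) ((stdSimplex.{u} 0).map_id (op ⦋0⦌ₛ)))

/-- The unit isomorphism `X ≅ Δ^0 ⊗ X` as a map. -/
noncomputable def toUnitProd (X : SemiSSet.{u}) : X ⟶ geomProd (stdSimplex 0) X where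
  app n := ↾(fun x : X.obj n =>
    (⟨collapse _, ⟨n.unop, 𝟙 _, inferInstance, x⟩, fun _ _ h => congrArg Prod.snd h⟩ :
      GeomProdSimplex (stdSimplex 0) X n.unop))
  naturality m _ f := ConcreteCategory.hom_ext _ _ fun x : X.obj m =>
    GeomProdSimplex.ext (collapse_restrict (toSimplexCategory.map f.unop)).symm
      (congrArg (fun t => t x) ((freeUnit X).naturality f))

instance isIso_toUnitProd (X : SemiSSet.{u}) : IsIso (toUnitProd X) := by
  have : ∀ n, IsIso ((toUnitProd X).app n) := by
    intro n
    rw [isIso_iff_bijective]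
    constructor
    · intro x y h
      have h := congrArg GeomProdSimplex.snd h
      exact eq_of_heq (FreeSimplex.mk.inj h).2.2
    · rintro ⟨⟨a, p, hp, s⟩, ⟨b, q, hq, x⟩, hpq⟩
      obtain ⟨s⟩ := s
      have ha : a = ⦋0⦌ₛ := by
        have h1 := Fintype.card_le_of_injective _ (homEquiv s).injective
        ext
        simpa using h1
      subst ha
      have hq' : Mono q := by
        rw [SimplexCategory.mono_iff_injective]
        intro i j hij
        exact hpq (Prod.ext (Subsingleton.elim (α := Fin 1) _ _) hij)
      have hb : n.unop = b := by
        have h1 := SimplexCategory.len_le_of_mono q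
        have h2 := SimplexCategory.len_le_of_epi q
        ext
        exact le_antisymm h1 h2
      subst hb
      obtain rfl := SimplexCategory.eq_id_of_mono q
      refine ⟨x, GeomProdSimplex.ext ?_ rfl⟩
      have hs : s = 𝟙 _ := by
        apply homEquiv.injective
        ext i
        exact congrArg Fin.val (Subsingleton.elim (α := Fin 1) _ _)
      subst hs
      obtain rfl : p = SimplexCategory.const _ ⦋0⦌ 0 := Subsingleton.elim (α := _ ⟶ ⦋0⦌) _ _
      rfl
  exact NatIso.isIso_of_isIso_app _

/-- The order embedding of a one-point order with value `ε`. -/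
def vertexEmbedding (ε : Fin 2) : Fin 1 ↪o Fin 2 :=
  OrderEmbedding.ofStrictMono (fun _ => ε) (Subsingleton.strictMono _)

/-- The inclusion `Δ^0 ⟶ Δ^1` of the vertex `ε`. -/
def vertexInclusion (ε : Fin 2) : stdSimplex.{u} 0 ⟶ stdSimplex 1 :=
  uliftYoneda.{u}.map (homEquiv.symm (vertexEmbedding ε))

/-- The inclusion of `X` at the end `ε` of the cylinder `Δ^1 ⊗ X`. -/
noncomputable def cylinderEnd (ε : Fin 2) (X : SemiSSet.{u}) : X ⟶ geomProd (stdSimplex 1) X :=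
  toUnitProd X ≫ geomProdMap (vertexInclusion ε) (𝟙 X)

/-- There is a homotopy `Δ^1 ⊗ X ⟶ Y` from `f` to `g`. -/
def Homotopic {X Y : SemiSSet.{u}} (f g : X ⟶ Y) : Prop :=
  ∃ H : geomProd (stdSimplex 1) X ⟶ Y, cylinderEnd 0 X ≫ H = f ∧ cylinderEnd 1 X ≫ H = g

/-- Homotopy equivalences. -/
def IsHomotopyEquiv {X Y : SemiSSet.{u}} (f : X ⟶ Y) : Prop :=
  ∃ g : Y ⟶ X, Homotopic (f ≫ g) (𝟙 X) ∧ Homotopic (g ≫ f) (𝟙 Y)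

/-- Weak equivalences: maps that extend, along anodyne maps into fibrant objects, to a homotopy
equivalence between fibrant objects. -/
def weakEquivalences : MorphismProperty SemiSSet.{u} := fun A B f =>
  ∃ (X Y : SemiSSet.{u}) (i : A ⟶ X) (j : B ⟶ Y) (g : X ⟶ Y),
    anodyne i ∧ anodyne j ∧ IsFibrant X ∧ IsFibrant Y ∧ i ≫ g = f ≫ j ∧ IsHomotopyEquiv g

end SemiSSet

/-!
The unit `η : A ⟶ U (L A)` is in fact anodyne. Given this, a fibrant replacement `Y` of `U (L A)`
is, by composition with `η`, also a fibrant replacement of `A`, and `η` is a weak equivalence as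
soon as `𝟙 Y` is a homotopy equivalence. The cylinder `Δ¹ ⊗ Y` does not project to `Y`, but it
projects to `U (L Y)`, and as `η` is anodyne at `Y` the identity of `Y` extends to a retraction
`U (L Y) ⟶ Y`; this gives the constant homotopy (`homotopic_refl`).

For `A = Δ⁰`, let `U (L A)` be the semisimplicial set with one simplex `y⋯y` in each dimension, and
consider the cone on it: its simplices are the nonempty words `y⋯y` and `xy⋯y`. The cone retracts to
`U (L A)` by replacing `x` by `y`. The inclusion of the vertex `y` in the cone is anodyne: fill
the horn `y` of the edge `xy` (the new face is `x`), then successively the horns of `xyy`, `xyyy`, …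
missing the face `yy`, `yyy`, …. So the inclusion of `y` in `U (L A)`, a retract of an anodyne map,
is anodyne.

For a general `A` the same is done in every fibre of a degeneracy operator. A simplex of `U (L A)`
is a simplex of `A` with a surjection `[n] ⟶ [a]`; a `MarkedSimplex` is such a simplex with some fibres
`xy⋯y` instead of `y⋯y`. Adding and removing marks makes `U (L A)` a retract of the semisimplicial
set of marked simplices, compatibly with the maps from `A`. The inclusion of `A` in the latter is
anodyne (`markedMatching`, `Matching.anodyne`): a simplex outside of `A` is matched with another one
by modifying its first fibre that is not `y`, exchanging `xy` with `x`, and `xy⋯y` with `y⋯y`.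
-/

universe v w

namespace SemiSSet

open SemiSimplexCategory (toSimplexCategory homOfMono homEquiv)

/-! ### Fibrant replacement -/

-- The index category is countable, so that all horns are `ℵ₁`-presentable.
local instance fact_isRegular_aleph_one : Fact (Cardinal.aleph.{u} 1).IsRegular :=
  ⟨Cardinal.isRegular_aleph_one⟩

noncomputable local instance orderBotAlephOneOrdToType :
    OrderBot (Cardinal.aleph.{u} 1).ord.ToType :=
  have : Nonempty (Cardinal.aleph.{u} 1).ord.ToType := by
    rw [Ordinal.nonempty_toType_iff, Ne, Cardinal.ord_eq_zero]
    exact (Cardinal.aleph_pos 1).ne'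
  WellFoundedLT.toOrderBot _

instance : Countable SemiSimplexCategory :=
  Function.Injective.countable (f := SemiSimplexCategory.len) fun _ _ h => by ext; exact h

instance (a b : SemiSimplexCategory) : Finite (a ⟶ b) :=
  Finite.of_injective (fun f => (homEquiv f : Fin (a.len + 1) → Fin (b.len + 1)))
    (DFunLike.coe_injective.comp homEquiv.injective)

/-- A levelwise countable semisimplicial set is a colimit of representables over its category of
elements, which is countable. -/
theorem isCardinalPresentable_of_countable (P : SemiSSet.{u}) [∀ n, Countable (P.obj n)] :
    IsCardinalPresentable P (Cardinal.aleph.{u} 1) := by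
  have : Countable P.Elementsᵒᵖ := by
    have : Countable P.Elements := by
      have : Countable SemiSimplexCategoryᵒᵖ := equivToOpposite.symm.injective.countable
      exact inferInstanceAs (Countable (Σ c, P.obj c))
    exact equivToOpposite.symm.injective.countable
  have h (a b : P.Elementsᵒᵖ) : Countable (a ⟶ b) := by
    have : Countable (b.unop.1 ⟶ a.unop.1) := (opEquiv _ _).injective.countable
    have : Countable (b.unop ⟶ a.unop) := Subtype.val_injective.countable
    exact (opEquiv _ _).injective.countable
  have hK : Countable (Arrow P.Elementsᵒᵖ) :=
    Function.Surjective.countable (f := fun (x : Σ (a b : P.Elementsᵒᵖ), a ⟶ b) => Arrow.mk x.2.2)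
      fun f => ⟨⟨_, _, f.hom⟩, rfl⟩
  have (k : P.Elementsᵒᵖ) : IsCardinalPresentable
      ((Presheaf.functorToRepresentables.{u} P).obj k) (Cardinal.aleph.{u} 1) :=
    inferInstanceAs (IsCardinalPresentable (uliftYoneda.{u}.obj _) _)
  refine isCardinalPresentable_of_isColimit' (C := SemiSSet.{u}) _
    (Presheaf.colimitOfRepresentable.{u} P) _ ?_
  rw [HasCardinalLT, Cardinal.lift_id, Cardinal.lift_aleph]
  simp

instance : MorphismProperty.IsSmall.{u} HornInclusions.{u} := by
  have hI : HornInclusions.{u} = MorphismProperty.ofHoms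
      (fun i : Σ n : {n : ℕ // 1 ≤ n}, Fin (n.1 + 1) => (horn.{u} i.1.1 i.2).ι) := by
    ext A B f
    constructor
    · rintro ⟨n, hn, k⟩
      exact MorphismProperty.ofHoms.mk (⟨⟨n, hn⟩, k⟩ : Σ n : {n : ℕ // 1 ≤ n}, Fin (n.1 + 1))
    · rintro ⟨⟨⟨n, hn⟩, k⟩⟩
      exact ⟨n, hn, k⟩
  have hs : Small.{u} (Σ n : {n : ℕ // 1 ≤ n}, Fin (n.1 + 1)) := inferInstance
  rw [hI]
  infer_instance

instance : HornInclusions.{u}.IsCardinalForSmallObjectArgument (Cardinal.aleph.{u} 1) where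
  preservesColimit {A B X Y} i hi f hf := by
    have : IsCardinalPresentable A (Cardinal.aleph.{u} 1) := by
      obtain ⟨n, hn, k⟩ := hi
      have (m : SemiSimplexCategoryᵒᵖ) : Countable ((horn.{u} n k).toFunctor.obj m) := by
        have : Countable ((stdSimplex.{u} n).obj m) :=
          ULift.down_injective.countable (β := m.unop ⟶ ⦋n⦌ₛ)
        exact Subtype.val_injective.countable
      exact isCardinalPresentable_of_countable _
    have := preservesColimitsOfShape_of_isCardinalPresentable A (Cardinal.aleph.{u} 1)
      (Cardinal.aleph.{u} 1).ord.ToType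
    infer_instance

instance : MorphismProperty.HasSmallObjectArgument.{u} HornInclusions.{u} :=
  ⟨Cardinal.aleph.{u} 1, inferInstance, inferInstance, inferInstance⟩

/-- The small object argument provides fibrant replacements along anodyne maps. -/
theorem exists_anodyne_isFibrant (A : SemiSSet.{u}) :
    ∃ (X : SemiSSet.{u}) (i : A ⟶ X), anodyne i ∧ IsFibrant X := by
  let d := MorphismProperty.factorizationData HornInclusions.{u}.rlp.llp HornInclusions.{u}.rlp
    (Limits.terminal.from A)
  refine ⟨d.Z, d.i, d.hi, ?_⟩
  have := d.hp
  rwa [Subsingleton.elim d.p (Limits.terminal.from d.Z)] at this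

/-! ### Anodyne maps from acyclic matchings -/

/-- The coface map `[n] ⟶ [n + 1]` that omits `j`. -/
def coface {n : ℕ} (j : Fin (n + 2)) : ⦋n⦌ₛ ⟶ ⦋n + 1⦌ₛ :=
  homEquiv.symm (Fin.succAboveOrderEmb j)

theorem homEquiv_comp_coface {m : SemiSimplexCategory} {n : ℕ} (g : m ⟶ ⦋n⦌ₛ) (j : Fin (n + 2))
    (i : Fin (m.len + 1)) : homEquiv (g ≫ coface j) i = j.succAbove (homEquiv g i) := by
  rw [SemiSimplexCategory.homEquiv_comp]
  rfl

theorem hom_ext_apply {m n : SemiSimplexCategory} {f g : m ⟶ n}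
    (h : ∀ i, homEquiv f i = homEquiv g i) : f = g :=
  SemiSimplexCategory.hom_ext (RelEmbedding.ext h)

theorem exists_comp_coface {m : SemiSimplexCategory} {n : ℕ} (f : m ⟶ ⦋n + 1⦌ₛ)
    {j : Fin (n + 2)} (hj : ∀ i, homEquiv f i ≠ j) : ∃ g : m ⟶ ⦋n⦌ₛ, f = g ≫ coface j := by
  choose g hg using fun i => Fin.exists_succAbove_eq (hj i)
  refine ⟨homEquiv.symm (OrderEmbedding.ofStrictMono g fun a b hab => ?_),
    hom_ext_apply fun i => (hg i).symm⟩
  rw [← (Fin.strictMono_succAbove j).lt_iff_lt, hg, hg]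
  exact (homEquiv f).strictMono hab

theorem exists_eq_eqToHom {m n : SemiSimplexCategory} (f : m ⟶ n)
    (hf : Function.Surjective (homEquiv f)) : ∃ h : m = n, f = eqToHom h := by
  obtain rfl : m = n := by
    have := Fintype.card_of_bijective ⟨(homEquiv f).injective, hf⟩
    ext
    simpa using this
  refine ⟨rfl, hom_ext_apply fun i => ?_⟩
  exact congrFun ((StrictMono.range_inj (homEquiv f).strictMono strictMono_id).1
    (by rw [hf.range_eq, Set.range_id])) i

/-- The only simplices of `Δ^{n + 1}` outside the horn `Λ^{n + 1}_k` are the nondegenerate top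
simplex and its `k`-th face. -/
theorem horn_trichotomy {m : SemiSimplexCategory} {n : ℕ} (k : Fin (n + 2)) (f : m ⟶ ⦋n + 1⦌ₛ) :
    (∃ j, j ≠ k ∧ ∃ g : m ⟶ ⦋n⦌ₛ, f = g ≫ coface j) ∨
      (∃ h : m = ⦋n + 1⦌ₛ, f = eqToHom h) ∨ ∃ h : m = ⦋n⦌ₛ, f = eqToHom h ≫ coface k := by
  by_cases h : ∃ j, j ≠ k ∧ ∀ i, homEquiv f i ≠ j
  · obtain ⟨j, hj, hf⟩ := h
    exact Or.inl ⟨j, hj, exists_comp_coface f hf⟩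
  · push Not at h
    right
    by_cases hk : ∀ i, homEquiv f i ≠ k
    · right
      obtain ⟨g, rfl⟩ := exists_comp_coface f hk
      obtain ⟨rfl, rfl⟩ := exists_eq_eqToHom g fun j => by
        obtain ⟨i, hi⟩ := h (k.succAbove j) (Fin.succAbove_ne k j)
        rw [homEquiv_comp_coface] at hi
        exact ⟨i, Fin.succAbove_right_injective hi⟩
      exact ⟨rfl, rfl⟩
    · left
      push Not at hk
      exact exists_eq_eqToHom f fun j => by
        by_cases hj : j = k
        · exact hj ▸ hk
        · exact h j hj

theorem uliftYoneda_map_up {C : Type*} [Category.{v} C] {X Y Z : C} (f : X ⟶ Y) (g : Y ⟶ Z) :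
    (uliftYoneda.{w}.obj Z).map f.op (ULift.up g) = ULift.up (f ≫ g) := rfl

theorem stdSimplex_map_up {m n : SemiSimplexCategory} {k : ℕ} (f : m ⟶ n) (g : n ⟶ ⦋k⦌ₛ) :
    (stdSimplex.{u} k).map f.op (ULift.up g : (stdSimplex.{u} k).obj (op n)) =
      (ULift.up (f ≫ g) : (stdSimplex.{u} k).obj (op m)) :=
  uliftYoneda_map_up f g

theorem mem_horn_comp_coface {m : SemiSimplexCategory} {n : ℕ} {j k : Fin (n + 2)} (hj : j ≠ k)
    (g : m ⟶ ⦋n⦌ₛ) :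
    (ULift.up (g ≫ coface j) : (stdSimplex.{u} (n + 1)).obj (op m)) ∈ (horn (n + 1) k).obj (op m) :=
  ⟨j, hj, fun ⟨i, hi⟩ => Fin.succAbove_ne j _ ((homEquiv_comp_coface g j i).symm.trans hi)⟩

section Matching

variable {A W : SemiSSet.{u}}

theorem map_map_apply {n m l : SemiSimplexCategory} (f : n ⟶ m) (g : m ⟶ l) (w : W.obj (op l)) :
    W.map f.op (W.map g.op w) = W.map (f ≫ g).op w := by
  rw [op_comp, W.map_comp]; rfl

theorem map_id_apply {n : SemiSimplexCategory} (w : W.obj (op n)) : W.map (𝟙 n).op w = w := by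
  rw [op_id, W.map_id]; rfl

theorem sigma_eq_of_map_eqToHom {m n : ℕ} (h : ⦋m⦌ₛ = ⦋n⦌ₛ) {w : W.obj (op ⦋n⦌ₛ)}
    {w' : W.obj (op ⦋m⦌ₛ)} (hw : W.map (eqToHom h).op w = w') :
    (⟨m, w'⟩ : Σ n : ℕ, W.obj (op ⦋n⦌ₛ)) = ⟨n, w⟩ := by
  obtain rfl : m = n := congrArg SemiSimplexCategory.len h
  rw [eqToHom_refl, map_id_apply] at hw
  rw [hw]

/-- An acyclic matching on the complement of a monomorphism `i : A ⟶ W`: a family of simplices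
`top t`, each with a distinguished face (the one opposite to the vertex `index t`), such that the
simplices `top t` and their distinguished faces are outside `A` and pairwise distinct, such that `A`
and the simplices `top t` generate `W`, and such that every other face of `top t` is in `A` or is a
face of some `top t'` with `t'` smaller than `t`, for a well-founded relation. -/
structure Matching (i : A ⟶ W) where
  Idx : Type u
  dim : Idx → ℕ
  top (t : Idx) : W.obj (op ⦋dim t + 1⦌ₛ)
  index (t : Idx) : Fin (dim t + 2)
  lt : Idx → Idx → Prop
  wf : WellFounded lt
  injective (n) : Function.Injective (i.app n)
  cover {n : SemiSimplexCategory} (w : W.obj (op n)) :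
    w ∈ Set.range (i.app (op n)) ∨ ∃ (t : Idx) (f : n ⟶ ⦋dim t + 1⦌ₛ), W.map f.op (top t) = w
  lower (t : Idx) (j : Fin (dim t + 2)) (hj : j ≠ index t) :
    W.map (coface j).op (top t) ∈ Set.range (i.app _) ∨
      ∃ (t' : Idx) (f : ⦋dim t⦌ₛ ⟶ ⦋dim t' + 1⦌ₛ), lt t' t ∧
        W.map f.op (top t') = W.map (coface j).op (top t)
  face_notMem (t : Idx) : W.map (coface (index t)).op (top t) ∉ Set.range (i.app _)
  face_ne_top (t t' : Idx) :
    (⟨dim t, W.map (coface (index t)).op (top t)⟩ : Σ n : ℕ, W.obj (op ⦋n⦌ₛ)) ≠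
      ⟨dim t' + 1, top t'⟩
  face_injective : Function.Injective fun t =>
    (⟨dim t, W.map (coface (index t)).op (top t)⟩ : Σ n : ℕ, W.obj (op ⦋n⦌ₛ))

namespace Matching

variable {i : A ⟶ W}

/-- The distinguished face of the simplex `M.top t`. -/
def face (M : Matching i) (t : M.Idx) : W.obj (op ⦋M.dim t⦌ₛ) :=
  W.map (coface (M.index t)).op (M.top t)

variable {X Y : SemiSSet.{u}}

/-- The graph of a solution of the lifting problem of `i` against `p` given by `φ` and `ψ`, on a
part of `W` that contains `A` and contains `M.top t` as soon as it contains `M.face t`: `G n w x` means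
that the solution is defined at `w`, with value `x`. -/
structure IsPartialLift (M : Matching i) (p : X ⟶ Y) (φ : A ⟶ X) (ψ : W ⟶ Y)
    (G : ∀ n : SemiSimplexCategoryᵒᵖ, W.obj n → X.obj n → Prop) : Prop where
  map {n m} (f : n ⟶ m) {w x} : G n w x → G m (W.map f w) (X.map f x)
  functional {n w x x'} : G n w x → G n w x' → x = x'
  comm {n w x} : G n w x → p.app n x = ψ.app n w
  base {n} (a : A.obj n) : G n (i.app n a) (φ.app n a)
  matched {t x} : G _ (M.face t) x → ∃ y, G _ (M.top t) y

variable {p : X ⟶ Y} {φ : A ⟶ X} {ψ : W ⟶ Y}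

theorem exists_maximal_isPartialLift (M : Matching i) (sq : φ ≫ p = i ≫ ψ) :
    ∃ G, Maximal (M.IsPartialLift p φ ψ) G := by
  have h := zorn_le_nonempty₀ {G | M.IsPartialLift p φ ψ G} ?_
    (fun n w x => ∃ a, i.app n a = w ∧ φ.app n a = x) ?_
  · obtain ⟨G, -, hG⟩ := h
    exact ⟨G, hG⟩
  · intro c hc hchain G₀ hG₀
    refine ⟨fun n w x => ∃ G ∈ c, G n w x, ?_, fun G hG n w x h => ⟨G, hG, h⟩⟩
    constructor
    · rintro n m f w x ⟨G, hG, h⟩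
      exact ⟨G, hG, (hc hG).map f h⟩
    · rintro n w x x' ⟨G, hG, h⟩ ⟨G', hG', h'⟩
      obtain hle | hle := hchain.total hG hG'
      · exact (hc hG').functional (hle _ _ _ h) h'
      · exact (hc hG).functional h (hle _ _ _ h')
    · rintro n w x ⟨G, hG, h⟩
      exact (hc hG).comm h
    · intro n a
      exact ⟨G₀, hG₀, (hc hG₀).base a⟩
    · rintro t x ⟨G, hG, h⟩
      obtain ⟨y, hy⟩ := (hc hG).matched h
      exact ⟨y, G, hG, hy⟩
  · constructor
    · rintro n m f _ _ ⟨a, rfl, rfl⟩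
      exact ⟨A.map f a, NatTrans.naturality_apply i f a, NatTrans.naturality_apply φ f a⟩
    · rintro n w _ _ ⟨a, rfl, rfl⟩ ⟨b, h, rfl⟩
      rw [M.injective n h]
    · rintro n _ _ ⟨a, rfl, rfl⟩
      exact congrArg (fun q : A ⟶ Y => q.app n a) sq
    · exact fun a => ⟨a, rfl, rfl⟩
    · rintro t x ⟨a, h, -⟩
      -- Vacuous: distinguished faces are outside `A`.
      exact (M.face_notMem t ⟨a, h⟩).elim

/-- A partial lift extends over `M.top t` as soon as it is defined on all smaller simplices of the
matching, by filling a horn. -/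
theorem exists_isPartialLift_top (M : Matching i) (hp : fibrations p)
    {G : ∀ n : SemiSimplexCategoryᵒᵖ, W.obj n → X.obj n → Prop}
    (hG : M.IsPartialLift p φ ψ G) (t : M.Idx)
    (ht : ∀ t', M.lt t' t → ∃ x, G _ (M.top t') x) :
    ∃ G', M.IsPartialLift p φ ψ G' ∧ G ≤ G' ∧ ∃ x, G' _ (M.top t) x := by
  by_cases htop : ∃ x, G _ (M.top t) x
  · exact ⟨G, hG, le_rfl, htop⟩
  have hface : ¬ ∃ x, G _ (M.face t) x := fun ⟨x, hx⟩ => htop (hG.matched hx)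
  have hdom (j : Fin (M.dim t + 2)) (hj : j ≠ M.index t) :
      ∃ x, G _ (W.map (coface j).op (M.top t)) x := by
    obtain ⟨a, ha⟩ | ⟨t', f, hlt, hf⟩ := M.lower t j hj
    · exact ⟨_, ha ▸ hG.base a⟩
    · obtain ⟨x, hx⟩ := ht t' hlt
      rw [← hf]
      exact ⟨_, hG.map f.op hx⟩
  have hhorn {m : SemiSimplexCategoryᵒᵖ}
      (s : (horn.{u} (M.dim t + 1) (M.index t)).toFunctor.obj m) :
      ∃ x, G m (W.map (ULift.down (α := m.unop ⟶ ⦋M.dim t + 1⦌ₛ) s.1).op (M.top t)) x := by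
    obtain ⟨⟨s⟩, j, hj, hs⟩ := s
    obtain ⟨g, rfl⟩ := exists_comp_coface s (j := j) fun i hi => hs ⟨i, hi⟩
    obtain ⟨x, hx⟩ := hdom j hj
    have := hG.map g.op hx
    rw [map_map_apply] at this
    exact ⟨_, this⟩
  choose F hF using @hhorn
  have hF' {m m' : SemiSimplexCategory} (f : m ⟶ m') (s : m' ⟶ ⦋M.dim t + 1⦌ₛ)
      (hs : (ULift.up s : (stdSimplex.{u} _).obj (op m')) ∈ (horn _ (M.index t)).obj (op m')) :
      F ((horn _ (M.index t)).toFunctor.map f.op ⟨ULift.up s, hs⟩) =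
        X.map f.op (F ⟨ULift.up s, hs⟩) := by
    refine hG.functional (hF _) ?_
    have h1 := hG.map f.op (hF ⟨ULift.up s, hs⟩)
    have h2 := stdSimplex_map_up.{u} f s
    have h3 := congrArg (fun q : (stdSimplex.{u} (M.dim t + 1)).obj (op m) =>
      W.map (ULift.down (α := m ⟶ ⦋M.dim t + 1⦌ₛ) q).op (M.top t)) h2
    rw [map_map_apply] at h1
    exact (congrArg (fun q => G _ q _) h3).mpr h1
  -- The known values on the faces of `M.top t` form a horn in `X`; `x₀` is a filler over `ψ`.
  let top : (horn.{u} (M.dim t + 1) (M.index t)).toFunctor ⟶ X :=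
    { app m := ↾fun s => F s
      naturality m m' f := ConcreteCategory.hom_ext _ _ fun s => hF' f.unop s.1.down s.2 }
  let bot : stdSimplex.{u} (M.dim t + 1) ⟶ Y := uliftYonedaEquiv.symm (ψ.app _ (M.top t))
  have hsq : top ≫ p = (horn.{u} (M.dim t + 1) (M.index t)).ι ≫ bot := by
    ext m s
    have h1 := hG.comm (hF s)
    have h2 := NatTrans.naturality_apply ψ
      (Quiver.Hom.op (ULift.down (α := m.unop ⟶ ⦋M.dim t + 1⦌ₛ) s.1)) (M.top t)
    exact h1.trans h2
  have := hp _ (HornInclusions.mk (M.dim t + 1) (by omega) (M.index t))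
  let sq : CommSq top (horn.{u} (M.dim t + 1) (M.index t)).ι p bot := ⟨hsq⟩
  let x₀ : X.obj (op ⦋M.dim t + 1⦌ₛ) := uliftYonedaEquiv sq.lift
  have hx₀ {m : SemiSimplexCategory} (f : m ⟶ ⦋M.dim t + 1⦌ₛ) :
      X.map f.op x₀ = sq.lift.app (op m) (ULift.up f) := by
    have := NatTrans.naturality_apply sq.lift f.op
      (ULift.up (𝟙 ⦋M.dim t + 1⦌ₛ) : (stdSimplex.{u} (M.dim t + 1)).obj (op ⦋M.dim t + 1⦌ₛ))
    rw [stdSimplex_map_up, Category.comp_id] at this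
    exact this.symm
  have hlow {m : SemiSimplexCategory} (j : Fin (M.dim t + 2)) (hj : j ≠ M.index t)
      (g : m ⟶ ⦋M.dim t⦌ₛ) :
      G _ (W.map (g ≫ coface j).op (M.top t)) (X.map (g ≫ coface j).op x₀) := by
    have h1 := hF ⟨ULift.up (g ≫ coface j), mem_horn_comp_coface.{u} hj g⟩
    have h2 := congrArg (fun q => q.app (op m)
      ⟨ULift.up (g ≫ coface j), mem_horn_comp_coface.{u} hj g⟩) sq.fac_left
    have h3 : X.map (g ≫ coface j).op x₀ =
      F ⟨ULift.up (g ≫ coface j), mem_horn_comp_coface.{u} hj g⟩ := (hx₀ _).trans h2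
    rw [h3]
    exact h1
  -- The only faces of `M.top t` where `G` is undefined are `M.top t` itself and `M.face t`.
  have hnot {m : SemiSimplexCategory} (f : m ⟶ ⦋M.dim t + 1⦌ₛ) {x}
      (hx : G _ (W.map f.op (M.top t)) x) :
      ∃ j ≠ M.index t, ∃ g : m ⟶ ⦋M.dim t⦌ₛ, f = g ≫ coface j := by
    obtain h | ⟨rfl, rfl⟩ | ⟨rfl, rfl⟩ := horn_trichotomy (M.index t) f
    · exact h
    · rw [eqToHom_refl, map_id_apply] at hx
      exact (htop ⟨_, hx⟩).elim
    · rw [eqToHom_refl, Category.id_comp] at hx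
      exact (hface ⟨_, hx⟩).elim
  have hfun {m : SemiSimplexCategory} (f : m ⟶ ⦋M.dim t + 1⦌ₛ) {x}
      (hx : G _ (W.map f.op (M.top t)) x) : x = X.map f.op x₀ := by
    obtain ⟨j, hj, g, rfl⟩ := hnot f hx
    exact hG.functional hx (hlow j hj g)
  have hfun' {m : SemiSimplexCategory} (f g : m ⟶ ⦋M.dim t + 1⦌ₛ)
      (h : W.map f.op (M.top t) = W.map g.op (M.top t)) : X.map f.op x₀ = X.map g.op x₀ := by
    obtain ⟨j, hj, f, rfl⟩ | ⟨rfl, rfl⟩ | ⟨rfl, rfl⟩ := horn_trichotomy (M.index t) f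
    · exact hfun g (h ▸ hlow j hj f)
    all_goals
      obtain ⟨j, hj, g, rfl⟩ | ⟨h', rfl⟩ | ⟨h', rfl⟩ := horn_trichotomy (M.index t) g
      · exact (hfun _ (h.symm ▸ hlow j hj g)).symm
      · first | rfl | (have := congrArg SemiSimplexCategory.len h'; simp at this)
      · first | rfl | (have := congrArg SemiSimplexCategory.len h'; simp at this)
  -- The extended graph relates each face of `M.top t` to the corresponding face of `x₀`.
  refine ⟨fun n w x => G n w x ∨ ∃ f : n.unop ⟶ ⦋M.dim t + 1⦌ₛ,
    W.map f.op (M.top t) = w ∧ X.map f.op x₀ = x, ?_, fun n w x h => Or.inl h,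
    x₀, Or.inr ⟨𝟙 _, map_id_apply _, map_id_apply _⟩⟩
  constructor
  · rintro n m f w x (h | ⟨g, rfl, rfl⟩)
    · exact Or.inl (hG.map f h)
    · exact Or.inr ⟨f.unop ≫ g, (map_map_apply f.unop g _).symm, (map_map_apply f.unop g _).symm⟩
  · rintro n w x x' (h | ⟨f, rfl, rfl⟩) (h' | ⟨f', h', rfl⟩)
    · exact hG.functional h h'
    · subst h'
      exact hfun f' h
    · exact (hfun f h').symm
    · exact hfun' f f' h'.symm
  · rintro n w x (h | ⟨f, rfl, rfl⟩)
    · exact hG.comm h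
    · have h1 := congrArg (fun q => q.app n (ULift.up f)) sq.fac_right
      have h2 := NatTrans.naturality_apply ψ f.op (M.top t)
      exact ((congrArg (p.app n) (hx₀ f)).trans h1).trans h2.symm
  · exact fun a => Or.inl (hG.base a)
  · rintro t' x (h | ⟨f, hf, -⟩)
    · obtain ⟨y, hy⟩ := hG.matched h
      exact ⟨y, Or.inl hy⟩
    · obtain ⟨j, hj, g, rfl⟩ | ⟨h', rfl⟩ | ⟨h', rfl⟩ := horn_trichotomy (M.index t) f
      · obtain ⟨y, hy⟩ := hG.matched (hf ▸ hlow j hj g)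
        exact ⟨y, Or.inl hy⟩
      · exact (M.face_ne_top t' t (sigma_eq_of_map_eqToHom h' hf)).elim
      · rw [← map_map_apply] at hf
        obtain rfl := M.face_injective (sigma_eq_of_map_eqToHom h' hf)
        exact ⟨x₀, Or.inr ⟨𝟙 _, map_id_apply _, map_id_apply _⟩⟩

/-- A monomorphism whose complement has an acyclic matching is anodyne. -/
theorem anodyne (M : Matching i) : anodyne i := by
  intro X Y p hp
  constructor
  intro φ ψ sq
  obtain ⟨G, hG⟩ := M.exists_maximal_isPartialLift sq.w
  have htop (t : M.Idx) : ∃ x, G _ (M.top t) x := by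
    induction t using M.wf.induction with
    | _ t ih =>
      obtain ⟨G', hG', hle, x, hx⟩ := M.exists_isPartialLift_top hp hG.prop t ih
      exact ⟨x, hG.le_of_ge hG' hle _ _ _ hx⟩
  have hall {n : SemiSimplexCategoryᵒᵖ} (w : W.obj n) : ∃ x, G n w x := by
    obtain ⟨a, rfl⟩ | ⟨t, f, rfl⟩ := M.cover w
    · exact ⟨_, hG.prop.base a⟩
    · obtain ⟨x, hx⟩ := htop t
      exact ⟨_, hG.prop.map f.op hx⟩
  choose F hF using @hall
  refine ⟨⟨⟨{ app n := ↾fun w => F w, naturality := ?_ }, ?_, ?_⟩⟩⟩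
  · exact fun n m f => ConcreteCategory.hom_ext _ _ fun w =>
      hG.prop.functional (hF _) (hG.prop.map f (hF w))
  · ext n a
    exact hG.prop.functional (hF _) (hG.prop.base a)
  · ext n w
    exact hG.prop.comm (hF w)

end Matching
end Matching

/-! ### Formally degenerate simplices with marked vertices -/

theorem val_succAbove {n : ℕ} (j : Fin (n + 1)) (i : Fin n) :
    (j.succAbove i : ℕ) = if (i : ℕ) < j then (i : ℕ) else i + 1 := by
  rw [Fin.succAbove]
  simp only [Fin.lt_def, Fin.val_castSucc]
  split_ifs <;> simp

theorem val_predAbove {n : ℕ} (c : Fin n) (i : Fin (n + 1)) :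
    (c.predAbove i : ℕ) = if (c : ℕ) < i then (i : ℕ) - 1 else i := by
  rw [Fin.predAbove]
  simp only [Fin.lt_def, Fin.val_castSucc]
  split_ifs <;> simp

theorem predAbove_succAbove_of_eq {n : ℕ} {c : Fin (n + 1)} {k : Fin (n + 2)}
    (hk : k = c.castSucc ∨ k = c.succ) (i : Fin (n + 1)) : c.predAbove (k.succAbove i) = i := by
  ext
  rw [val_predAbove, val_succAbove]
  obtain rfl | rfl := hk <;> simp only [Fin.val_castSucc, Fin.val_succ] <;> split_ifs <;> omega

namespace FreeSimplex

variable {A : SemiSSet.{u}}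

/-- Two vertices of a formally degenerate simplex are identified by its degeneracy operator. -/
def Glued {n : SimplexCategory} (x : FreeSimplex A n) (i j : Fin (n.len + 1)) : Prop :=
  x.proj.toOrderHom i = x.proj.toOrderHom j

theorem glued_restrict {m n : SimplexCategory} (f : m ⟶ n) (x : FreeSimplex A n)
    (i j : Fin (m.len + 1)) :
    (x.restrict f).Glued i j ↔ x.Glued (f.toOrderHom i) (f.toOrderHom j) := by
  have e k := congrArg (fun t => SimplexCategory.Hom.toOrderHom t k)
    (imageProj_imageIncl (f ≫ x.proj))
  constructor
  · intro h
    exact (e i).symm.trans ((congrArg _ h).trans (e j))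
  · intro h
    exact (homEquiv (imageIncl (f ≫ x.proj))).injective ((e i).trans (Eq.trans h (e j).symm))

theorem Glued.of_le {n : SimplexCategory} {x : FreeSimplex A n} {i j k : Fin (n.len + 1)}
    (h : x.Glued i k) (hij : i ≤ j) (hjk : j ≤ k) : x.Glued i j :=
  le_antisymm (x.proj.toOrderHom.monotone hij)
    ((x.proj.toOrderHom.monotone hjk).trans_eq (Eq.symm h))

theorem restrict_eq_self {n : SimplexCategory} (x : FreeSimplex A n) (f : n ⟶ n)
    (h : ∀ i, x.Glued (f.toOrderHom i) i) : x.restrict f = x := by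
  rw [restrict_eq f x x.proj x.epi (𝟙 _)]
  · simp
  · ext i
    simpa using congrArg Fin.val (h i).symm

/-- A simplex whose vertices are pairwise not glued is nondegenerate. -/
theorem exists_freeUnit {n : SemiSimplexCategory}
    (x : FreeSimplex A (toSimplexCategory.obj n)) (h : ∀ i j, x.Glued i j → i = j) :
    ∃ a : A.obj (op n), (freeUnit A).app (op n) a = x := by
  obtain ⟨d, q, hq, a⟩ := x
  have hq' : Mono q := SimplexCategory.mono_iff_injective.2 fun i j hij => h i j hij
  obtain rfl : n = d := by
    have h1 := SimplexCategory.len_le_of_mono q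
    have h2 := SimplexCategory.len_le_of_epi q
    ext
    exact le_antisymm h1 h2
  obtain rfl := SimplexCategory.eq_id_of_mono q
  exact ⟨a, rfl⟩

end FreeSimplex

/-- A simplex of the free simplicial set on `A` with a set of marked vertices, such that only
the first vertex of a fibre of the degeneracy operator may be marked. Over a vertex of the simplex
of `A`, the fibre is thus a word `y⋯y` or `xy⋯y`, where `x` stands for a marked vertex and `y` for
an unmarked one. -/
@[ext]
structure MarkedSimplex (A : SemiSSet.{u}) (n : SemiSimplexCategory) : Type u where
  free : FreeSimplex A (toSimplexCategory.obj n)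
  marked : Set (Fin (n.len + 1))
  not_glued : ∀ ⦃i j⦄, i ∈ marked → j < i → ¬ free.Glued j i

namespace MarkedSimplex

variable {A : SemiSSet.{u}}

/-- The action of a monomorphism `f : [m] ⟶ [n]`. -/
noncomputable def restrict {m n : SemiSimplexCategory} (f : m ⟶ n) (x : MarkedSimplex A n) :
    MarkedSimplex A m where
  free := x.free.restrict (toSimplexCategory.map f)
  marked := homEquiv f ⁻¹' x.marked
  not_glued _ _ hi hj h :=
    x.not_glued hi ((homEquiv f).strictMono hj) ((FreeSimplex.glued_restrict _ _ _ _).1 h)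

theorem glued_restrict {m n : SemiSimplexCategory} (f : m ⟶ n) (x : MarkedSimplex A n)
    (i j : Fin (m.len + 1)) :
    (x.restrict f).free.Glued i j ↔ x.free.Glued (homEquiv f i) (homEquiv f j) :=
  FreeSimplex.glued_restrict _ _ _ _

/-- The vertex `i` is bare if it is unmarked and the last one in its fibre. -/
def Bare {n : SemiSimplexCategory} (x : MarkedSimplex A n) (i : Fin (n.len + 1)) : Prop :=
  i ∉ x.marked ∧ ∀ j, i < j → ¬ x.free.Glued i j

theorem Bare.restrict {m n : SemiSimplexCategory} {f : m ⟶ n} {x : MarkedSimplex A n}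
    {i : Fin (m.len + 1)} (h : x.Bare (homEquiv f i)) : (x.restrict f).Bare i :=
  ⟨h.1, fun _ hj hij => h.2 _ ((homEquiv f).strictMono hj) ((glued_restrict _ _ _ _).1 hij)⟩

/-- The first vertex of `x` that is not bare is `c`. -/
def FirstNotBare {n : SemiSimplexCategory} (x : MarkedSimplex A n) (c : Fin (n.len + 1)) : Prop :=
  ¬ x.Bare c ∧ ∀ i < c, x.Bare i

theorem FirstNotBare.unique {n : SemiSimplexCategory} {x : MarkedSimplex A n}
    {c c' : Fin (n.len + 1)} (h : x.FirstNotBare c) (h' : x.FirstNotBare c') : c = c' :=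
  le_antisymm (le_of_not_gt fun hlt => h'.1 (h.2 _ hlt))
    (le_of_not_gt fun hlt => h.1 (h'.2 _ hlt))

/-- The vertex `c` is marked, and it is not alone in its fibre. -/
def Full {n : SemiSimplexCategory} (x : MarkedSimplex A n) (c : Fin (n.len + 1)) : Prop :=
  c ∈ x.marked ∧ ∃ j, c < j ∧ x.free.Glued c j

theorem Full.not_bare {n : SemiSimplexCategory} {x : MarkedSimplex A n} {c : Fin (n.len + 1)}
    (h : x.Full c) : ¬ x.Bare c := fun h' => h'.1 h.1

theorem forall_bare_or_exists_firstNotBare {n : SemiSimplexCategory} (x : MarkedSimplex A n) :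
    (∀ i, x.Bare i) ∨ ∃ c, x.FirstNotBare c := by
  by_cases h : ∀ i, x.Bare i
  · exact Or.inl h
  · push Not at h
    refine Or.inr ⟨WellFounded.min wellFounded_lt {i | ¬ x.Bare i} h,
      WellFounded.min_mem wellFounded_lt {i | ¬ x.Bare i} h, fun i hi => ?_⟩
    by_contra hi'
    exact WellFounded.not_lt_min wellFounded_lt {i | ¬ x.Bare i} hi' hi

section Expand

variable {n : ℕ}

/-- Double the vertex `c`, marking the first copy and not the second one. -/
noncomputable def expand (y : MarkedSimplex A ⦋n⦌ₛ) (c : Fin (n + 1)) (h : ∀ i < c, y.Bare i) :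
    MarkedSimplex A ⦋n + 1⦌ₛ where
  free := y.free.restrict (SimplexCategory.σ c)
  marked := Set.ofPred fun i : Fin (n + 2) =>
    i = c.castSucc ∨ c.succ < i ∧ c.predAbove i ∈ y.marked
  not_glued := by
    change ∀ ⦃i j : Fin (n + 2)⦄, _ → j < i → _
    rintro i j (rfl | ⟨hi, hi'⟩) hj hij
    · have hij' : y.free.Glued (c.predAbove j) (c.predAbove c.castSucc) :=
        (FreeSimplex.glued_restrict _ _ _ _).1 hij
      have h1 : c.predAbove j < c := by
        rw [Fin.lt_def, val_predAbove] at *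
        split_ifs <;> simp at * <;> omega
      rw [Fin.predAbove_castSucc_self] at hij'
      exact (h _ h1).2 _ h1 hij'
    · have hij' : y.free.Glued (c.predAbove j) (c.predAbove i) :=
        (FreeSimplex.glued_restrict _ _ _ _).1 hij
      refine y.not_glued hi' ?_ hij'
      change c.predAbove j < c.predAbove i
      rw [Fin.lt_def, val_predAbove, val_predAbove]
      simp only [Fin.lt_def, Fin.val_succ] at *
      split_ifs <;> omega

theorem glued_expand (y : MarkedSimplex A ⦋n⦌ₛ) (c : Fin (n + 1)) (h : ∀ i < c, y.Bare i)
    (i j : Fin (n + 2)) :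
    (y.expand c h).free.Glued i j ↔ y.free.Glued (c.predAbove i) (c.predAbove j) :=
  FreeSimplex.glued_restrict _ _ _ _

theorem mem_marked_expand (y : MarkedSimplex A ⦋n⦌ₛ) (c : Fin (n + 1)) (h : ∀ i < c, y.Bare i)
    (i : Fin (n + 2)) :
    i ∈ (y.expand c h).marked ↔ i = c.castSucc ∨ c.succ < i ∧ c.predAbove i ∈ y.marked :=
  Iff.rfl

theorem full_expand (y : MarkedSimplex A ⦋n⦌ₛ) (c : Fin (n + 1)) (h : ∀ i < c, y.Bare i) :
    (y.expand c h).Full c.castSucc := by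
  refine ⟨Or.inl rfl, c.succ, Fin.castSucc_lt_succ, ?_⟩
  rw [glued_expand, Fin.predAbove_castSucc_self, Fin.predAbove_succ_self]
  rfl

theorem bare_expand (y : MarkedSimplex A ⦋n⦌ₛ) (c : Fin (n + 1)) (h : ∀ i < c, y.Bare i)
    (i : Fin (n + 2)) (hi : i < c.castSucc) : (y.expand c h).Bare i := by
  rw [Fin.lt_def, Fin.val_castSucc] at hi
  have h1 : c.predAbove i < c := by
    rw [Fin.lt_def, val_predAbove]
    split_ifs <;> omega
  refine ⟨?_, fun j hj => ?_⟩
  · rw [mem_marked_expand]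
    simp only [Fin.ext_iff, Fin.lt_def, Fin.val_castSucc, Fin.val_succ]
    omega
  · change Fin (n + 2) at j
    rw [glued_expand]
    refine (h _ h1).2 _ ?_
    change c.predAbove i < c.predAbove j
    rw [Fin.lt_def] at *
    rw [val_predAbove, val_predAbove]
    split_ifs <;> omega

theorem firstNotBare_expand (y : MarkedSimplex A ⦋n⦌ₛ) (c : Fin (n + 1)) (h : ∀ i < c, y.Bare i) :
    (y.expand c h).FirstNotBare c.castSucc :=
  ⟨(y.full_expand c h).not_bare, y.bare_expand c h⟩

/-- A simplex is a face of its expansion at the first vertex that is not bare, provided that this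
vertex is not full. -/
theorem exists_restrict_expand (y : MarkedSimplex A ⦋n⦌ₛ) (c : Fin (n + 1)) (hc : y.FirstNotBare c)
    (hc' : ¬ y.Full c) : ∃ j, (y.expand c hc.2).restrict (coface j) = y := by
  have hfree (k : Fin (n + 2)) (hk : k = c.castSucc ∨ k = c.succ) :
      ((y.expand c hc.2).restrict (coface k)).free = y.free := by
    refine (y.free.restrict_comp (toSimplexCategory.map (coface k))
      (SimplexCategory.σ c)).symm.trans (y.free.restrict_eq_self _ fun i => ?_)
    exact congrArg y.free.proj.toOrderHom (predAbove_succAbove_of_eq hk i)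
  have hmark (k : Fin (n + 2)) (hk : k = c.castSucc ∨ k = c.succ) (i : Fin (n + 1)) :
      i ∈ ((y.expand c hc.2).restrict (coface k)).marked ↔
        k.succAbove i = c.castSucc ∨ c.succ < k.succAbove i ∧ i ∈ y.marked := by
    have := y.mem_marked_expand c hc.2 (k.succAbove i)
    rwa [predAbove_succAbove_of_eq hk] at this
  by_cases hm : c ∈ y.marked
  · refine ⟨c.succ, MarkedSimplex.ext (hfree _ (Or.inr rfl)) (Set.ext fun i => ?_)⟩
    change Fin (n + 1) at i
    rw [hmark _ (Or.inr rfl), Fin.ext_iff, Fin.lt_def, val_succAbove, Fin.val_castSucc,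
      Fin.val_succ]
    obtain hi | rfl | hi := lt_trichotomy i c
    · have := (hc.2 i hi).1
      rw [Fin.lt_def] at hi
      simp only [this, and_false, or_false, iff_false]
      split_ifs <;> omega
    · simp [hm]
    · rw [Fin.lt_def] at hi
      rw [if_neg (by omega)]
      constructor
      · rintro (h | h)
        · omega
        · exact h.2
      · exact fun h => Or.inr ⟨by omega, h⟩
  · refine ⟨c.castSucc, MarkedSimplex.ext (hfree _ (Or.inl rfl)) (Set.ext fun i => ?_)⟩
    change Fin (n + 1) at i
    rw [hmark _ (Or.inl rfl), Fin.lt_def, val_succAbove, Fin.val_castSucc, Fin.val_succ]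
    simp only [Fin.succAbove_ne, false_or]
    refine ⟨And.right, fun h => ⟨?_, h⟩⟩
    have h1 : ¬ i < c := fun hi => (hc.2 i hi).1 h
    have h2 : i ≠ c := fun hi => hm (hi ▸ h)
    rw [Fin.lt_def] at h1
    rw [Ne, Fin.ext_iff] at h2
    rw [if_neg h1]
    omega

/-- The index of the distinguished face of a simplex that is full at `c`: a fibre `xyy⋯y` is sent to
`yy⋯y` by omitting `c`, and the fibre `xy` to `x` by omitting the vertex after `c`. -/
noncomputable def faceIndex (w : MarkedSimplex A ⦋n + 1⦌ₛ) (c : Fin (n + 1)) : Fin (n + 2) :=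
  open Classical in
  if ∃ j : Fin (n + 2), c.succ < j ∧ w.free.Glued c.castSucc j then c.castSucc else c.succ

theorem glued_succ_of_full {w : MarkedSimplex A ⦋n + 1⦌ₛ} {c : Fin (n + 1)}
    (h : w.Full c.castSucc) : w.free.Glued c.castSucc c.succ := by
  obtain ⟨-, j, hj, hj'⟩ := h
  exact hj'.of_le (Fin.castSucc_lt_succ).le (Fin.castSucc_lt_iff_succ_le.1 hj)

theorem faceIndex_eq (w : MarkedSimplex A ⦋n + 1⦌ₛ) (c : Fin (n + 1)) :
    (w.faceIndex c = c.castSucc ∧ ∃ j : Fin (n + 2), c.succ < j ∧ w.free.Glued c.castSucc j) ∨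
      (w.faceIndex c = c.succ ∧ ∀ j : Fin (n + 2), c.succ < j → ¬ w.free.Glued c.castSucc j) := by
  unfold faceIndex
  split_ifs with h
  · exact Or.inl ⟨rfl, h⟩
  · push Not at h
    exact Or.inr ⟨rfl, h⟩

theorem mem_marked_restrict_coface (w : MarkedSimplex A ⦋n + 1⦌ₛ) (k : Fin (n + 2))
    (i : Fin (n + 1)) : i ∈ (w.restrict (coface k)).marked ↔ k.succAbove i ∈ w.marked := Iff.rfl

theorem glued_restrict_coface (w : MarkedSimplex A ⦋n + 1⦌ₛ) (k : Fin (n + 2))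
    (i j : Fin (n + 1)) : (w.restrict (coface k)).free.Glued i j ↔
      w.free.Glued (k.succAbove i) (k.succAbove j) :=
  glued_restrict (coface k) w i j

theorem bare_restrict_coface {w : MarkedSimplex A ⦋n + 1⦌ₛ} {k : Fin (n + 2)}
    {i : Fin (n + 1)} (h : w.Bare (k.succAbove i)) : (w.restrict (coface k)).Bare i :=
  Bare.restrict (f := coface k) h

theorem succ_notMem_marked {w : MarkedSimplex A ⦋n + 1⦌ₛ} {c : Fin (n + 1)}
    (h : w.Full c.castSucc) : c.succ ∉ w.marked := fun h' =>
  w.not_glued h' Fin.castSucc_lt_succ (glued_succ_of_full h)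

theorem not_full_face {w : MarkedSimplex A ⦋n + 1⦌ₛ} {c : Fin (n + 1)}
    (h : w.Full c.castSucc) : ¬ (w.restrict (coface (w.faceIndex c))).Full c := by
  rintro ⟨h1, (j : Fin (n + 1)), hj, h2⟩
  rw [mem_marked_restrict_coface] at h1
  rw [glued_restrict_coface] at h2
  obtain ⟨hk, -⟩ | ⟨hk, hk'⟩ := w.faceIndex_eq c
  · rw [hk, Fin.succAbove_castSucc_self] at h1
    exact succ_notMem_marked h h1
  · rw [hk, Fin.succAbove_succ_self] at h2
    refine hk' _ ?_ h2
    rw [Fin.lt_def] at *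
    rw [val_succAbove, Fin.val_succ]
    split_ifs <;> omega

theorem firstNotBare_face {w : MarkedSimplex A ⦋n + 1⦌ₛ} {c : Fin (n + 1)}
    (h : w.FirstNotBare c.castSucc) (h' : w.Full c.castSucc) :
    (w.restrict (coface (w.faceIndex c))).FirstNotBare c := by
  obtain ⟨hk, j, hj, hj'⟩ | ⟨hk, -⟩ := w.faceIndex_eq c
  · rw [hk]
    refine ⟨fun hb => ?_, fun (i : Fin (n + 1)) hi => bare_restrict_coface (h.2 _ ?_)⟩
    · obtain ⟨j, rfl⟩ := Fin.exists_succAbove_eq (Fin.castSucc_lt_succ.trans hj).ne'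
      refine hb.2 j ?_ ?_
      · change c < j
        rw [Fin.lt_def] at *
        rw [val_succAbove, Fin.val_succ] at hj
        split_ifs at hj <;> omega
      · rw [glued_restrict_coface, Fin.succAbove_castSucc_self]
        exact (Eq.symm (glued_succ_of_full h')).trans hj'
    · change c.castSucc.succAbove i < c.castSucc
      rw [Fin.lt_def] at *
      rw [val_succAbove, Fin.val_castSucc, if_pos hi]
      exact hi
  · rw [hk]
    refine ⟨fun hb => hb.1 ?_, fun (i : Fin (n + 1)) hi => bare_restrict_coface (h.2 _ ?_)⟩
    · rw [mem_marked_restrict_coface, Fin.succAbove_succ_self]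
      exact h'.1
    · change c.succ.succAbove i < c.castSucc
      rw [Fin.lt_def] at *
      rw [val_succAbove, Fin.val_castSucc, Fin.val_succ]
      split_ifs <;> omega

/-- Expansion recovers a full simplex from its distinguished face. -/
theorem expand_face {w : MarkedSimplex A ⦋n + 1⦌ₛ} {c : Fin (n + 1)}
    (h : w.FirstNotBare c.castSucc) (h' : w.Full c.castSucc) :
    (w.restrict (coface (w.faceIndex c))).expand c (firstNotBare_face h h').2 = w := by
  have hk : w.faceIndex c = c.castSucc ∨ w.faceIndex c = c.succ :=
    (w.faceIndex_eq c).imp And.left And.left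
  have hval (i : Fin (n + 2)) (hi : (i : ℕ) < c ∨ c + 1 < (i : ℕ)) :
      (w.faceIndex c).succAbove (c.predAbove i) = i := by
    ext
    rw [val_succAbove, val_predAbove]
    obtain hk | hk := hk <;> rw [hk] <;> simp only [Fin.val_castSucc, Fin.val_succ] <;>
      split_ifs <;> omega
  apply MarkedSimplex.ext
  · refine (w.free.restrict_comp (SimplexCategory.σ c)
      (toSimplexCategory.map (coface (w.faceIndex c)))).symm.trans
      (w.free.restrict_eq_self _ fun (i : Fin (n + 2)) => ?_)
    change w.free.Glued ((w.faceIndex c).succAbove (c.predAbove i)) i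
    by_cases hi : (i : ℕ) < c ∨ c + 1 < (i : ℕ)
    · rw [hval i hi]
      rfl
    · have hi' : c.predAbove i = c := by
        ext
        rw [val_predAbove]
        split_ifs <;> omega
      have hi'' : i = c.castSucc ∨ i = c.succ := by
        simp only [Fin.ext_iff, Fin.val_castSucc, Fin.val_succ]
        omega
      have hg := glued_succ_of_full h'
      rw [hi']
      obtain hk | hk := hk <;> rw [hk] <;> obtain rfl | rfl := hi'' <;>
        simp only [Fin.succAbove_castSucc_self, Fin.succAbove_succ_self]
      exacts [hg.symm, rfl, rfl, hg]
  · refine Set.ext fun (i : Fin (n + 2)) => ?_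
    rw [mem_marked_expand, mem_marked_restrict_coface]
    obtain hi | rfl | hi := lt_trichotomy i c.castSucc
    · have h1 := (h.2 i hi).1
      simp only [h1, iff_false]
      simp only [Fin.ext_iff, Fin.lt_def, Fin.val_castSucc, Fin.val_succ] at *
      omega
    · simp [h'.1]
    · obtain rfl | hi := (Fin.castSucc_lt_iff_succ_le.1 hi).eq_or_lt
      · simp [succ_notMem_marked h', Fin.ext_iff]
      · rw [hval i (Or.inr (by simpa [Fin.lt_def] using hi))]
        simp only [hi, true_and, or_iff_right_iff_imp]
        rintro rfl
        exact (Fin.castSucc_lt_succ.not_gt hi).elim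

/-- Passing from a simplex that is full at its first vertex that is not bare to a face other than
the distinguished one either gives a simplex of the same kind or increases the position of the first
vertex that is not bare; this makes the matching acyclic. -/
theorem lt_of_firstNotBare_restrict_coface {w : MarkedSimplex A ⦋n + 1⦌ₛ} {c : Fin (n + 1)}
    (h : w.FirstNotBare c.castSucc) (h' : w.Full c.castSucc) {j : Fin (n + 2)}
    (hj : j ≠ w.faceIndex c) {c' : Fin (n + 1)}
    (hc' : (w.restrict (coface j)).FirstNotBare c') (hc'' : ¬ (w.restrict (coface j)).Full c') :
    c < c' := by
  have hnb : ¬ w.Bare (j.succAbove c') := fun hb => hc'.1 (bare_restrict_coface hb)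
  have hle : c.castSucc ≤ j.succAbove c' := le_of_not_gt fun hlt => hnb (h.2 _ hlt)
  -- The vertices `c` and `c + 1` of `w` cannot be the vertex `c'` of the face, unless `c < c'`.
  obtain heq | hlt := hle.eq_or_lt
  · refine (hc'' ⟨?_, ?_⟩).elim
    · rw [mem_marked_restrict_coface, ← heq]
      exact h'.1
    · have : ∃ i : Fin (n + 2), i ≠ j ∧ c.castSucc < i ∧ w.free.Glued c.castSucc i := by
        by_cases hjc : j = c.succ
        · obtain ⟨-, i, hi, hi'⟩ | ⟨hk, -⟩ := w.faceIndex_eq c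
          · exact ⟨i, hjc ▸ hi.ne', Fin.castSucc_lt_succ.trans hi, hi'⟩
          · exact (hj (hjc.trans hk.symm)).elim
        · exact ⟨c.succ, Ne.symm hjc, Fin.castSucc_lt_succ, glued_succ_of_full h'⟩
      obtain ⟨i, hij, hi, hi'⟩ := this
      obtain ⟨i, rfl⟩ := Fin.exists_succAbove_eq hij
      refine ⟨i, ?_, ?_⟩
      · rw [heq] at hi
        exact (Fin.strictMono_succAbove j).lt_iff_lt.1 hi
      · rw [glued_restrict_coface, ← heq]
        exact hi'
  · obtain heq | hlt := (Fin.castSucc_lt_iff_succ_le.1 hlt).eq_or_lt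
    · by_contra hcc
      have hv := congrArg Fin.val heq
      rw [val_succAbove, Fin.val_succ] at hv
      rw [Fin.lt_def] at hcc
      have hjc : j ≤ c.castSucc := by
        rw [Fin.le_def, Fin.val_castSucc]
        split_ifs at hv <;> omega
      obtain hjc | hjc := hjc.eq_or_lt
      · obtain ⟨hk, -⟩ | ⟨-, hk⟩ := w.faceIndex_eq c
        · exact hj (hjc.trans hk.symm)
        · refine hnb (heq ▸ ⟨succ_notMem_marked h', fun i hi hg => hk i hi ?_⟩)
          exact (glued_succ_of_full h').trans hg
      · obtain ⟨e, he⟩ := Fin.exists_succAbove_eq hjc.ne'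
        have hlt : e < c' := by
          rw [← (Fin.strictMono_succAbove j).lt_iff_lt, he, ← heq]
          exact Fin.castSucc_lt_succ
        have hb := (hc'.2 e hlt).1
        rw [mem_marked_restrict_coface, he] at hb
        -- The marked vertex `c` of `w` would be a bare vertex of the face.
        exact hb h'.1
    · rw [Fin.lt_def] at *
      rw [val_succAbove, Fin.val_succ] at hlt
      split_ifs at hlt <;> omega

end Expand

end MarkedSimplex

/-! ### The unit is anodyne -/

theorem MarkedSimplex.restrict_id {A : SemiSSet.{u}} {n : SemiSimplexCategory}
    (x : MarkedSimplex A n) : x.restrict (𝟙 n) = x :=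
  MarkedSimplex.ext ((congrArg (fun t => x.free.restrict t) (toSimplexCategory.map_id _)).trans
    x.free.restrict_id) (Set.ext fun i => by
      change homEquiv (𝟙 n) i ∈ x.marked ↔ i ∈ x.marked
      rw [SemiSimplexCategory.homEquiv_id]
      rfl)

theorem MarkedSimplex.restrict_comp {A : SemiSSet.{u}} {k m n : SemiSimplexCategory}
    (g : k ⟶ m) (f : m ⟶ n) (x : MarkedSimplex A n) :
    x.restrict (g ≫ f) = (x.restrict f).restrict g :=
  MarkedSimplex.ext ((congrArg (fun t => x.free.restrict t) (toSimplexCategory.map_comp g f)).trans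
    (x.free.restrict_comp _ _)) (Set.ext fun i => by
      change homEquiv (g ≫ f) i ∈ x.marked ↔ homEquiv f (homEquiv g i) ∈ x.marked
      rw [SemiSimplexCategory.homEquiv_comp]
      rfl)

/-- The semisimplicial set of marked simplices. -/
noncomputable def markedSimplices (A : SemiSSet.{u}) : SemiSSet.{u} where
  obj n := MarkedSimplex A n.unop
  map f := ↾(MarkedSimplex.restrict f.unop)
  map_id n := ConcreteCategory.hom_ext _ _ fun x : MarkedSimplex A n.unop => x.restrict_id
  map_comp {n _ _} f g := ConcreteCategory.hom_ext _ _ fun x : MarkedSimplex A n.unop =>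
    x.restrict_comp g.unop f.unop

/-- Forgetting the marked vertices. -/
noncomputable def forgetMarking (A : SemiSSet.{u}) :
    markedSimplices A ⟶ forgetDegeneracies.obj (free.obj A) where
  app _ := ↾(MarkedSimplex.free)

/-- The simplices without marked vertices. -/
noncomputable def unmarked (A : SemiSSet.{u}) :
    forgetDegeneracies.obj (free.obj A) ⟶ markedSimplices A where
  app n := ↾(fun x : FreeSimplex A (toSimplexCategory.obj n.unop) =>
    (⟨x, ∅, fun _ _ h => h.elim⟩ : MarkedSimplex A n.unop))

/-- The inclusion of `A` as the unmarked nondegenerate simplices. -/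
noncomputable def markedUnit (A : SemiSSet.{u}) : A ⟶ markedSimplices A := freeUnit A ≫ unmarked A

theorem freeUnit_injective (A : SemiSSet.{u}) (n : SemiSimplexCategoryᵒᵖ) :
    Function.Injective ((freeUnit A).app n) := fun _ _ h =>
  eq_of_heq (FreeSimplex.mk.inj h).2.2

/-- The image of `A` consists of the marked simplices all of whose fibres are `y`. -/
theorem mem_range_markedUnit {A : SemiSSet.{u}} {n : SemiSimplexCategory} (x : MarkedSimplex A n) :
    x ∈ Set.range ((markedUnit A).app (op n)) ↔ ∀ i, x.Bare i := by
  constructor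
  · rintro ⟨a, rfl⟩ i
    exact ⟨fun h => h, fun j hj h => hj.ne h⟩
  · intro h
    obtain ⟨a, ha⟩ := x.free.exists_freeUnit fun i j hij => by
      obtain hlt | heq | hlt := lt_trichotomy i j
      · exact ((h i).2 j hlt hij).elim
      · exact heq
      · exact ((h j).2 i hlt hij.symm).elim
    exact ⟨a, MarkedSimplex.ext ha (Set.eq_empty_of_forall_notMem fun i => (h i).1).symm⟩

theorem MarkedSimplex.FirstNotBare.notMem_range {A : SemiSSet.{u}} {n : SemiSimplexCategory}
    {x : MarkedSimplex A n} {c : Fin (n.len + 1)} (h : x.FirstNotBare c) :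
    x ∉ Set.range ((markedUnit A).app (op n)) := fun h' =>
  h.1 ((mem_range_markedUnit x).1 h' c)

/-- A marked simplex that is full at its first vertex that is not bare. These are the top simplices
of the matching on the complement of `A`. -/
structure FullSimplex (A : SemiSSet.{u}) : Type u where
  dim : ℕ
  simplex : MarkedSimplex A ⦋dim + 1⦌ₛ
  vertex : Fin (dim + 1)
  first : simplex.FirstNotBare vertex.castSucc
  full : simplex.Full vertex.castSucc

namespace FullSimplex

variable {A : SemiSSet.{u}}

/-- The expansion of a marked simplex that is not full at its first vertex that is not bare. -/
noncomputable def ofExpand {n : ℕ} (y : MarkedSimplex A ⦋n⦌ₛ) (c : Fin (n + 1))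
    (h : y.FirstNotBare c) : FullSimplex A :=
  ⟨n, y.expand c h.2, c, y.firstNotBare_expand c h.2, y.full_expand c h.2⟩

/-- The distinguished face of a full simplex. -/
noncomputable def face (t : FullSimplex A) : MarkedSimplex A ⦋t.dim⦌ₛ :=
  t.simplex.restrict (coface (t.simplex.faceIndex t.vertex))

theorem firstNotBare_face (t : FullSimplex A) : t.face.FirstNotBare t.vertex :=
  MarkedSimplex.firstNotBare_face t.first t.full

theorem not_full_face (t : FullSimplex A) : ¬ t.face.Full t.vertex :=
  MarkedSimplex.not_full_face t.full

theorem ofExpand_face (t : FullSimplex A) : ofExpand t.face t.vertex t.firstNotBare_face = t := by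
  have := MarkedSimplex.expand_face t.first t.full
  obtain ⟨n, w, c, h, h'⟩ := t
  simp only [ofExpand, face, this]

/-- A marked simplex that is full at its first vertex that is not bare has positive dimension, so
that it comes from a full simplex. -/
theorem exists_of_full {n : SemiSimplexCategory} {x : MarkedSimplex A n} {c : Fin (n.len + 1)}
    (h : x.FirstNotBare c) (h' : x.Full c) :
    ∃ (t : FullSimplex A) (f : n ⟶ ⦋t.dim + 1⦌ₛ), t.dim < n.len ∧ t.simplex.restrict f = x := by
  obtain ⟨n⟩ := n
  change Fin (n + 1) at c
  obtain ⟨-, (j : Fin (n + 1)), hj, -⟩ := id h'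
  obtain _ | n := n
  · exact (hj.ne (Subsingleton.elim (α := Fin 1) _ _)).elim
  · obtain ⟨c, rfl⟩ := Fin.exists_castSucc_eq.2 (hj.trans_le (Fin.le_last j)).ne
    exact ⟨⟨n, x, c, h, h'⟩, 𝟙 _, Nat.lt_succ_self n, x.restrict_id⟩

/-- Full simplices are ordered by dimension, then by decreasing position of their first vertex that
is not bare. -/
def lt (t' t : FullSimplex A) : Prop :=
  Prod.Lex (· < ·) (· < ·) (t'.dim, t'.dim - t'.vertex.val) (t.dim, t.dim - t.vertex.val)

theorem wf_lt : WellFounded (lt (A := A)) :=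
  InvImage.wf (fun t : FullSimplex A => (t.dim, t.dim - t.vertex.val))
    (WellFounded.prod_lex wellFounded_lt wellFounded_lt)

theorem exists_restrict_eq {n : SemiSimplexCategory} (w : MarkedSimplex A n) :
    (∀ i, w.Bare i) ∨
      ∃ (t : FullSimplex A) (f : n ⟶ ⦋t.dim + 1⦌ₛ), t.simplex.restrict f = w := by
  refine w.forall_bare_or_exists_firstNotBare.imp_right fun ⟨c, h⟩ => ?_
  by_cases hf : w.Full c
  · obtain ⟨t, f, -, ht⟩ := exists_of_full h hf
    exact ⟨t, f, ht⟩
  · obtain ⟨n⟩ := n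
    obtain ⟨j, hj⟩ := w.exists_restrict_expand c h hf
    exact ⟨ofExpand w c h, coface j, hj⟩

theorem exists_lt_restrict_eq (t : FullSimplex A) (j : Fin (t.dim + 2))
    (hj : j ≠ t.simplex.faceIndex t.vertex) :
    (∀ i, (t.simplex.restrict (coface j)).Bare i) ∨
      ∃ (t' : FullSimplex A) (f : ⦋t.dim⦌ₛ ⟶ ⦋t'.dim + 1⦌ₛ), t'.lt t ∧
        t'.simplex.restrict f = t.simplex.restrict (coface j) := by
  refine (MarkedSimplex.forall_bare_or_exists_firstNotBare _).imp_right fun ⟨c, h⟩ => ?_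
  by_cases hf : (t.simplex.restrict (coface j)).Full c
  · obtain ⟨t', f, hlt, ht'⟩ := exists_of_full h hf
    exact ⟨t', f, Prod.Lex.left _ _ hlt, ht'⟩
  · obtain ⟨i, hi⟩ := MarkedSimplex.exists_restrict_expand _ c h hf
    refine ⟨ofExpand _ c h, coface i, Prod.Lex.right _ ?_, hi⟩
    have h1 : t.vertex.val < c.val :=
      MarkedSimplex.lt_of_firstNotBare_restrict_coface t.first t.full hj h hf
    have h2 : c.val < t.dim + 1 := c.isLt
    change t.dim - c.val < t.dim - t.vertex.val
    omega

theorem sigma_face_ne (t t' : FullSimplex A) :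
    (⟨t.dim, t.face⟩ : Σ n : ℕ, MarkedSimplex A ⦋n⦌ₛ) ≠ ⟨t'.dim + 1, t'.simplex⟩ := by
  have key : ∀ (n : ℕ) (y : MarkedSimplex A ⦋n⦌ₛ) (c : Fin (n + 1)), y.FirstNotBare c →
      ¬ y.Full c → (⟨n, y⟩ : Σ n : ℕ, MarkedSimplex A ⦋n⦌ₛ) ≠ ⟨t'.dim + 1, t'.simplex⟩ := by
    rintro n y c hc hc' h
    obtain ⟨rfl, h⟩ := Sigma.mk.inj h
    obtain rfl := eq_of_heq h
    exact hc' (hc.unique t'.first ▸ t'.full)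
  exact key _ _ _ t.firstNotBare_face t.not_full_face

theorem sigma_face_injective : Function.Injective fun t : FullSimplex A =>
    (⟨t.dim, t.face⟩ : Σ n : ℕ, MarkedSimplex A ⦋n⦌ₛ) := by
  intro t t' h
  have key : ∀ (n n' : ℕ) (y : MarkedSimplex A ⦋n⦌ₛ) (y' : MarkedSimplex A ⦋n'⦌ₛ)
      (c : Fin (n + 1)) (c' : Fin (n' + 1)) (hc : y.FirstNotBare c) (hc' : y'.FirstNotBare c'),
      (⟨n, y⟩ : Σ n : ℕ, MarkedSimplex A ⦋n⦌ₛ) = ⟨n', y'⟩ →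
        ofExpand y c hc = ofExpand y' c' hc' := by
    rintro n n' y y' c c' hc hc' h
    obtain ⟨rfl, h⟩ := Sigma.mk.inj h
    obtain rfl := eq_of_heq h
    obtain rfl := hc.unique hc'
    rfl
  rw [← t.ofExpand_face, ← t'.ofExpand_face]
  exact key _ _ _ _ _ _ _ _ h

end FullSimplex

/-- Full simplices are matched with their distinguished faces. -/
noncomputable def markedMatching (A : SemiSSet.{u}) : Matching (markedUnit A) where
  Idx := FullSimplex A
  dim t := t.dim
  top t := t.simplex
  index t := t.simplex.faceIndex t.vertex
  lt := FullSimplex.lt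
  wf := FullSimplex.wf_lt
  injective n _ _ h := freeUnit_injective A n (congrArg MarkedSimplex.free h)
  cover w := (FullSimplex.exists_restrict_eq w).imp_left (mem_range_markedUnit _).2
  lower t j hj := (t.exists_lt_restrict_eq j hj).imp_left (mem_range_markedUnit _).2
  face_notMem t := t.firstNotBare_face.notMem_range
  face_ne_top t t' := t.sigma_face_ne t'
  face_injective := FullSimplex.sigma_face_injective

/-- The unit is a retract, under `A`, of the inclusion of `A` in the marked simplices. -/
theorem anodyne_freeUnit (A : SemiSSet.{u}) : anodyne (freeUnit A) := by
  refine MorphismProperty.of_retract (P := fibrations.llp) (f := freeUnit A) (g := markedUnit A) ?_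
    (markedMatching A).anodyne
  exact
    { i := Arrow.homMk (𝟙 A) (unmarked A)
      r := Arrow.homMk (𝟙 A) (forgetMarking A) }

/-- Homotopy is reflexive at the identity of a fibrant `X`. The cylinder has no projection to `X`,
but it projects to the free simplicial set on `X`, which retracts to `X` as the unit is anodyne. -/
theorem homotopic_refl {X : SemiSSet.{u}} (hX : IsFibrant X) : Homotopic (𝟙 X) (𝟙 X) := by
  have := anodyne_freeUnit X _ hX
  have sq : CommSq (𝟙 X) (freeUnit X) (Limits.terminal.from X) (Limits.terminal.from _) :=
    ⟨Subsingleton.elim _ _⟩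
  let snd : geomProd (stdSimplex 1) X ⟶ forgetDegeneracies.obj (free.obj X) :=
    { app n := ↾(fun x : GeomProdSimplex (stdSimplex 1) X n.unop => x.snd) }
  have h (ε : Fin 2) : cylinderEnd ε X ≫ snd = freeUnit X := rfl
  exact ⟨snd ≫ sq.lift, by rw [← Category.assoc, h, sq.fac_left],
    by rw [← Category.assoc, h, sq.fac_left]⟩

end SemiSSet

theorem mainTheorem4 (A : SemiSSet.{u}) :
    SemiSSet.cofibrations (SemiSSet.freeAdjunction.{u}.unit.app A) ∧
      SemiSSet.weakEquivalences (SemiSSet.freeAdjunction.{u}.unit.app A) := by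
  change SemiSSet.cofibrations (SemiSSet.freeUnit A) ∧
    SemiSSet.weakEquivalences (SemiSSet.freeUnit A)
  refine ⟨fun n => ⟨SemiSSet.freeUnit_injective A n, fun _ => Classical.em _⟩, ?_⟩
  obtain ⟨Y, j, hj, hY⟩ := SemiSSet.exists_anodyne_isFibrant
    (SemiSSet.forgetDegeneracies.obj (SemiSSet.free.obj A))
  refine ⟨Y, Y, SemiSSet.freeUnit A ≫ j, j, 𝟙 Y,
    MorphismProperty.comp_mem SemiSSet.fibrations.llp _ _ (SemiSSet.anodyne_freeUnit A) hj, hj,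
    hY, hY, by simp, 𝟙 Y, ?_, ?_⟩
  all_goals
    rw [Category.comp_id]
    exact SemiSSet.homotopic_refl hY
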